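/- All vector spaces are real and operators are linear and bounded. Let $E$ and $F$ be nonzero Banach lattices. A sequence $(x_n)$ in a Banach lattice is disjoint if $|x_m|\wedge|x_n|=0$ for $m\ne n$. A bounded set $A\subseteq F$ is an Lwc set if every disjoint sequence in its solid hull $\bigcup_{a\in A}[-|a|,|a|]$ is norm null. An operator $T:E\to F$ is oLwc (order L-weakly compact) if it maps order bounded subsets of $E$ onto Lwc subsets of $F$; it is oMwc (order M-weakly compact) if $f_n(Tx_n)\to 0$ for every order bounded sequence $(f_n)$ in $F^*$ and every disjoint norm bounded sequence $(x_n)$ in $E$. A Banach lattice is a KB-space if every increasing norm bounded sequence of positive elements converges in norm. Let $F^a$ be the order continuous part of $F$, that is, the set of all $x\in F$ such that $\|x_\alpha\|\to 0$ for every net $(x_\alpha)$ with $|x|\ge x_\alpha\downarrow 0$; thus $F=F^a$ means that the norm of $F$ is order continuous. Then: (i) $E^*$ is a KB-space if and only if every rank one operator $T:E\to F$ is oMwc; (ii) $F=F^a$ (i.e. $F$ has order continuous norm) if and only if every rank one operator $T:E\to F$ is oLwc. -/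

import Mathlib

open Filter Topology

/-- The usual order on the norm dual `E*` of an ordered normed space with a lattice order:
`f ≤ g` iff `f x ≤ g x` for all `x ≥ 0`. -/
instance dualPartialOrder {E : Type*} [NormedAddCommGroup E] [NormedSpace ℝ E] [Lattice E]
    [IsOrderedAddMonoid E] : PartialOrder (StrongDual ℝ E) where
  le f g := ∀ x : E, 0 ≤ x → f x ≤ g x
  le_refl _ _ _ := le_rfl
  le_trans _ _ _ hfg hgh x hx := (hfg x hx).trans (hgh x hx)
  le_antisymm f g hfg hgf := by
    have key : ∀ x : E, 0 ≤ x → f x = g x := fun x hx => le_antisymm (hfg x hx) (hgf x hx)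
    ext x
    rw [← posPart_sub_negPart x, map_sub, map_sub, key _ (posPart_nonneg x),
      key _ (negPart_nonneg x)]

/-- A set is order bounded if it is contained in an order interval `[a, b]`. -/
def IsOrderBounded {X : Type*} [Preorder X] (A : Set X) : Prop :=
  ∃ a b : X, A ⊆ Set.Icc a b

/-- KB-space: every increasing norm bounded sequence of positive elements converges in norm.
(The notion is applied to Banach lattices; only the norm and the order occur in it.) -/
def IsKBSpace (X : Type*) [NormedAddCommGroup X] [PartialOrder X] : Prop :=
  ∀ x : ℕ → X, Monotone x → (∀ n, 0 ≤ x n) → Bornology.IsBounded (Set.range x) →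
    ∃ l : X, Tendsto x atTop (𝓝 l)

/-- A disjoint sequence: `|x m| ∧ |x n| = 0` for `m ≠ n`. -/
def IsDisjointSeq {E : Type*} [AddCommGroup E] [Lattice E] (x : ℕ → E) : Prop :=
  Pairwise fun m n => |x m| ⊓ |x n| = 0

/-- The solid hull `sol(A) = ⋃_{a ∈ A} [-|a|, |a|]`. -/
def solidHull {E : Type*} [AddCommGroup E] [Lattice E] (A : Set E) : Set E :=
  ⋃ a ∈ A, Set.Icc (-|a|) |a|

/-- The order continuous part `E^a` of `E`: those `x` such that `‖d‖ → 0` along every net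
`d ↓ 0` in `[0, |x|]`. Nets `↓ 0` are given as nonempty downward directed sets `D` with
infimum `0`; the norm is monotone on positive elements, so convergence to `0` along `D` means
that `D` has elements of arbitrarily small norm. -/
def orderContinuousPart (E : Type*) [NormedAddCommGroup E] [Lattice E] : Set E :=
  {x | ∀ D : Set E, D.Nonempty → DirectedOn (fun a b => b ≤ a) D → IsGLB D 0 →
    (∀ d ∈ D, d ≤ |x|) → ∀ ε : ℝ, 0 < ε → ∃ d ∈ D, ‖d‖ < ε}

/-- Lwc set: a bounded set `A` such that every disjoint sequence in `sol(A)` is norm null. -/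
def IsLwcSet {E : Type*} [NormedAddCommGroup E] [Lattice E] (A : Set E) : Prop :=
  Bornology.IsBounded A ∧
    ∀ x : ℕ → E, IsDisjointSeq x → (∀ n, x n ∈ solidHull A) → Tendsto x atTop (𝓝 0)

section Operators

variable {E F : Type*} [NormedAddCommGroup E] [NormedSpace ℝ E] [Lattice E]
  [NormedAddCommGroup F] [NormedSpace ℝ F] [Lattice F]

/-- Order L-weakly compact (oLwc) operators: order bounded sets are mapped onto Lwc sets. -/
def IsOLwc (T : E →L[ℝ] F) : Prop :=
  ∀ A : Set E, IsOrderBounded A → IsLwcSet (T '' A)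

/-- Order M-weakly compact (oMwc) operators: `f n (T (x n)) → 0` for every order bounded
sequence `f` in `F*` and every disjoint bounded sequence `x` in `E`. -/
def IsOMwc [IsOrderedAddMonoid F] (T : E →L[ℝ] F) : Prop :=
  ∀ (f : ℕ → StrongDual ℝ F) (x : ℕ → E), IsOrderBounded (Set.range f) →
    IsDisjointSeq x → Bornology.IsBounded (Set.range x) →
    Tendsto (fun n => f n (T (x n))) atTop (𝓝 0)

/-- Rank one operators: the range has dimension one. -/
def IsRankOne (T : E →L[ℝ] F) : Prop :=
  (T : E →ₗ[ℝ] F).rank = 1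

end Operators

/-! A rank one operator is `x ↦ φ x • y`, which reduces both claims to disjoint sequences in one
space. Since `f n (T (x n)) = φ (x n) * f n y` with `f n y` bounded, (i) says that `E*` is KB iff
bounded disjoint sequences in `E` are weakly null. Since `T` maps order bounded sets into some
`[-C|y|, C|y|]`, (ii) says that the norm of `F` is order continuous iff order bounded disjoint
sequences are norm null.

For (i), a KB dual makes the increasing restrictions of a positive part to the ideals generated by
`∑ i < n, |x i|` converge in norm, and their increments dominate `φ (x n)`
(`eventually_apply_lt_of_isKBSpace_dual`). Conversely, a decreasing sequence of functionals tending
pointwise but not in norm to zero yields a disjoint sequence that is not weakly null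
(`exists_norm_le_of_antitone_dual`).

For (ii), partial sums of a disjoint sequence increase below a bound, and order continuity forces
small gaps. Conversely, slicing an increment along finitely many levels bounds it by terms that are
disjoint in `n` (`sub_le_add_sum_levels`), so downward directed sets are norm Cauchy. -/

theorem inf_eq_zero_of_le {E : Type*} [Lattice E] [Zero E] {a b a' b' : E} (ha' : 0 ≤ a') (hb' : 0 ≤ b') (ha : a' ≤ a)
    (hb : b' ≤ b) (h : a ⊓ b = 0) : a' ⊓ b' = 0 :=
  le_antisymm (h ▸ inf_le_inf ha hb) (le_inf ha' hb')

/-! ### Disjointness and identities in lattice ordered groups -/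

section LatticeGroup

variable {E : Type*} [AddCommGroup E] [Lattice E] [IsOrderedAddMonoid E]

theorem add_inf_le_inf_add_inf {a b z : E} (ha : 0 ≤ a) (hb : 0 ≤ b) (hz : 0 ≤ z) :
    (a + b) ⊓ z ≤ a ⊓ z + b ⊓ z := by
  rw [add_inf, inf_add, inf_add]
  refine le_inf (le_inf inf_le_left ?_) (le_inf ?_ ?_)
  · exact inf_le_right.trans (le_add_of_nonneg_right hb)
  · exact inf_le_right.trans (le_add_of_nonneg_left ha)
  · exact inf_le_right.trans (le_add_of_nonneg_left hz)

theorem add_inf_eq_zero {a b z : E} (ha : 0 ≤ a) (hb : 0 ≤ b) (hz : 0 ≤ z)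
    (haz : a ⊓ z = 0) (hbz : b ⊓ z = 0) : (a + b) ⊓ z = 0 := by
  refine le_antisymm ?_ (le_inf (add_nonneg ha hb) hz)
  simpa [haz, hbz] using add_inf_le_inf_add_inf ha hb hz

theorem nsmul_inf_eq_zero {a z : E} (ha : 0 ≤ a) (hz : 0 ≤ z) (haz : a ⊓ z = 0) (k : ℕ) :
    (k • a) ⊓ z = 0 := by
  induction k with
  | zero => simpa using hz
  | succ k ih =>
    rw [succ_nsmul]
    exact add_inf_eq_zero (nsmul_nonneg ha k) ha hz ih haz

theorem sum_inf_eq_zero {ι : Type*} (s : Finset ι) {x : ι → E} {z : E} (hx : ∀ i, 0 ≤ x i)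
    (hz : 0 ≤ z) (h : ∀ i ∈ s, x i ⊓ z = 0) : (∑ i ∈ s, x i) ⊓ z = 0 := by
  classical
  induction s using Finset.induction_on with
  | empty => simpa using hz
  | insert i s hi ih =>
    rw [Finset.sum_insert hi]
    exact add_inf_eq_zero (hx i) (Finset.sum_nonneg fun j _ => hx j) hz
      (h i (Finset.mem_insert_self i s)) (ih fun j hj => h j (Finset.mem_insert_of_mem hj))

theorem posPart_sub_inf_posPart_sub (a b : E) : (a - b)⁺ ⊓ (b - a)⁺ = 0 := by
  simpa [← negPart_def, ← posPart_neg] using posPart_inf_negPart_eq_zero (a - b)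

theorem IsDisjointSeq.of_lt {x : ℕ → E} (hx : ∀ n, 0 ≤ x n)
    (h : ∀ m n, m < n → x m ⊓ x n = 0) : IsDisjointSeq x := by
  intro m n hmn
  simp only [abs_of_nonneg (hx _)]
  rcases lt_or_gt_of_ne hmn with hlt | hlt
  · exact h m n hlt
  · rw [inf_comm]
    exact h n m hlt

/-- Disjoint positive elements have their supremum as sum, so any common bound also bounds the sum.
-/
theorem IsDisjointSeq.sum_range_abs_le {x : ℕ → E} (hx : IsDisjointSeq x) {w : E}
    (hw : ∀ n, |x n| ≤ w) (n : ℕ) : ∑ i ∈ Finset.range n, |x i| ≤ w := by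
  induction n with
  | zero => simpa using (abs_nonneg _).trans (hw 0)
  | succ n ih =>
    have h0 : (∑ i ∈ Finset.range n, |x i|) ⊓ |x n| = 0 :=
      sum_inf_eq_zero _ (fun i => abs_nonneg _) (abs_nonneg _)
        fun i hi => hx (Finset.mem_range.1 hi).ne
    rw [Finset.sum_range_succ, ← inf_add_sup, h0, zero_add]
    exact sup_le ih (hw n)

/-- By distributivity, the meet of the two bounds lies below `d ⊔ e` except for the term `t ⊓ (2 • d
- t)`, which `h` controls. -/
theorem le_sup_of_le_sup_of_le_sup {z d t e : E} (h₁ : z ≤ d ⊔ t) (h₂ : z ≤ e ⊔ (2 • d - t))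
    (h : t ⊓ (2 • d - t) ≤ d) : z ≤ d ⊔ e := by
  let _ := AddCommGroup.toDistribLattice E
  calc z ≤ (d ⊔ t) ⊓ (e ⊔ (2 • d - t)) := le_inf h₁ h₂
    _ = (d ⊓ (e ⊔ (2 • d - t))) ⊔ (t ⊓ e ⊔ t ⊓ (2 • d - t)) := by
      rw [inf_sup_right, inf_sup_left t]
    _ ≤ d ⊔ (e ⊔ d) := sup_le_sup inf_le_left (sup_le_sup inf_le_right h)
    _ = d ⊔ e := by rw [sup_comm e, ← sup_assoc, sup_idem]

/-- This is `p + q = 2 (p ⊓ q) + |p - q|` for `p = b - l`, `q = l - a`. -/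
theorem sub_le_two_nsmul_inf_add_abs (a b l : E) :
    b - a ≤ 2 • ((b - l)⁺ ⊓ (l - a)⁺) + |a + b - 2 • l| := by
  have h := two_nsmul_inf_eq_add_sub_abs_sub (b - l) (l - a)
  have h1 : (b - l) ⊓ (l - a) ≤ (b - l)⁺ ⊓ (l - a)⁺ :=
    inf_le_inf (le_posPart _) (le_posPart _)
  have h2 : b - a = 2 • ((b - l) ⊓ (l - a)) + |a + b - 2 • l| := by
    rw [h, abs_sub_comm (a + b)]
    have e1 : l - a - (b - l) = 2 • l - (a + b) := by abel
    rw [e1]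
    abel
  rw [h2]
  gcongr

end LatticeGroup

/-! ### Slicing an increment along equally spaced levels -/

section VectorLattice

variable {E : Type*} [AddCommGroup E] [Module ℝ E] [Lattice E] [IsOrderedAddMonoid E]
  [IsOrderedModule ℝ E]

theorem inf_two_nsmul_sub_le (t d : E) : t ⊓ (2 • d - t) ≤ d := by
  have h : (2 : ℝ) • (t ⊓ (2 • d - t)) ≤ (2 : ℝ) • d := by
    rw [two_smul ℝ, two_smul ℝ]
    calc _ ≤ t + (2 • d - t) := add_le_add inf_le_left inf_le_right
      _ = d + d := by abel
  have := smul_le_smul_of_nonneg_left h (by norm_num : (0 : ℝ) ≤ 2⁻¹)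
  simpa [smul_smul] using this

/-- If the levels `2 j d`, `j ≤ k`, are all at distance at least `z` from `c ≥ 0`, then `z ≤ d`
as soon as `c` does not exceed the last level. -/
theorem le_sup_of_le_abs_sub {z c d : E} (hc : 0 ≤ c) (k : ℕ)
    (h : ∀ j ≤ k, z ≤ |c - 2 • (j • d)|) : z ≤ d ⊔ (c - 2 • (k • d)) := by
  induction k with
  | zero =>
    have := h 0 le_rfl
    simp only [zero_smul, smul_zero, sub_zero, abs_of_nonneg hc] at this ⊢
    exact this.trans le_sup_right
  | succ k ih =>
    have e : c - 2 • ((k + 1) • d) = (c - 2 • (k • d)) - 2 • d := by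
      rw [succ_nsmul d, nsmul_add]; abel
    refine le_sup_of_le_sup_of_le_sup (ih fun j hj => h j (hj.trans k.le_succ)) ?_
      (inf_two_nsmul_sub_le _ _)
    have := h (k + 1) le_rfl
    rw [abs, e, neg_sub] at this
    rwa [e]

/-- For real numbers, `a + b` lies in `[0, 2w]`, hence within `d` of some `2 j d`, and the previous
estimate at level `j d` suffices. In a lattice no single `j` need work, so all slices are summed and
`le_sup_of_le_abs_sub` replaces the choice of `j`. -/
theorem sub_le_add_sum_levels {a b w d : E} (ha : 0 ≤ a) (hb : 0 ≤ b) (haw : a ≤ w) (hbw : b ≤ w)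
    (hd : 0 ≤ d) (k : ℕ) (hk : w ≤ k • d) :
    b - a ≤ d + 2 • ∑ j ∈ Finset.range (k + 1), ((b - j • d)⁺ ⊓ (j • d - a)⁺) := by
  have hy : ∀ j : ℕ, 0 ≤ (b - j • d)⁺ ⊓ (j • d - a)⁺ := fun j =>
    le_inf (posPart_nonneg _) (posPart_nonneg _)
  rw [← sub_le_iff_le_add]
  have := le_sup_of_le_abs_sub (z := b - a - 2 • ∑ j ∈ Finset.range (k + 1),
    ((b - j • d)⁺ ⊓ (j • d - a)⁺)) (add_nonneg ha hb) (d := d) k ?_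
  · refine this.trans (sup_le le_rfl ?_)
    rw [two_smul]
    have : a + b - (k • d + k • d) ≤ 0 := sub_nonpos.2 (add_le_add (haw.trans hk) (hbw.trans hk))
    exact this.trans hd
  · intro j hj
    rw [sub_le_iff_le_add']
    refine (sub_le_two_nsmul_inf_add_abs a b (j • d)).trans ?_
    gcongr
    exact Finset.single_le_sum (f := fun j : ℕ => (b - j • d)⁺ ⊓ (j • d - a)⁺) (fun i _ => hy i)
      (Finset.mem_range.2 (Nat.lt_succ_of_le hj))

end VectorLattice

/-! ### Order continuous norms and order bounded disjoint sequences -/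

section NormedLattice

variable {E : Type*} [NormedAddCommGroup E] [Lattice E] [IsOrderedAddMonoid E] [HasSolidNorm E]

theorem norm_le_norm_of_nonneg_of_le {a b : E} (ha : 0 ≤ a) (hab : a ≤ b) : ‖a‖ ≤ ‖b‖ :=
  norm_le_norm_of_abs_le_abs (abs_le_abs_of_nonneg ha hab)

theorem norm_posPart_le (a : E) : ‖a⁺‖ ≤ ‖a‖ := by
  refine norm_le_norm_of_abs_le_abs ?_
  rw [abs_of_nonneg (posPart_nonneg a)]
  exact sup_le (le_abs_self a) (abs_nonneg a)

theorem norm_negPart_le (a : E) : ‖a⁻‖ ≤ ‖a‖ := by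
  rw [← posPart_neg, ← norm_neg a]
  exact norm_posPart_le (-a)

theorem nonpos_of_forall_nsmul_le [NormedSpace ℝ E] [IsOrderedModule ℝ E] {v w : E}
    (h : ∀ k : ℕ, k • v ≤ w) : v ≤ 0 := by
  have hlim : Tendsto (fun k : ℕ => (1 / ((k : ℝ) + 1)) • w) atTop (𝓝 0) := by
    simpa using (tendsto_one_div_add_atTop_nhds_zero_nat (𝕜 := ℝ)).smul_const w
  refine ge_of_tendsto' hlim fun k => ?_
  have hk : (0 : ℝ) < (k : ℝ) + 1 := by positivity
  have := smul_le_smul_of_nonneg_left (h (k + 1)) (one_div_pos.2 hk).le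
  rw [← Nat.cast_smul_eq_nsmul ℝ, smul_smul] at this
  push_cast at this
  rwa [one_div_mul_cancel hk.ne', one_smul] at this

/-- The gaps between a bounded increasing sequence and its upper bounds decrease to zero. -/
theorem isGLB_upperBound_sub [NormedSpace ℝ E] [IsOrderedModule ℝ E] {s : ℕ → E} {w : E}
    (hw : ∀ n, s n ≤ w) :
    IsGLB {d | ∃ u n, (∀ k, s k ≤ u) ∧ u ≤ w ∧ d = u - s n} 0 := by
  constructor
  · rintro _ ⟨u, n, hu, -, rfl⟩
    exact sub_nonneg.2 (hu n)
  · intro v hv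
    -- A lower bound `v` of the gaps lets `v⁺` be subtracted from any upper bound `u ≤ w`, leaving
    -- an upper bound; iterating contradicts the Archimedean property unless `v ≤ 0`.
    have key : ∀ k : ℕ, ∀ n, s n ≤ w - k • v⁺ := by
      intro k
      induction k with
      | zero => simpa using hw
      | succ k ih =>
        intro n
        have hmem : w - k • v⁺ - s n ∈ {d | ∃ u n, (∀ k, s k ≤ u) ∧ u ≤ w ∧ d = u - s n} :=
          ⟨_, n, ih, sub_le_self _ (nsmul_nonneg (posPart_nonneg v) k), rfl⟩
        have h1 : v⁺ ≤ w - k • v⁺ - s n := sup_le (hv hmem) (sub_nonneg.2 (ih n))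
        rw [succ_nsmul]
        rw [le_sub_comm] at h1
        rwa [← sub_sub]
    refine (le_posPart v).trans (nonpos_of_forall_nsmul_le (w := w - s 0) fun k => ?_)
    rw [le_sub_comm]
    exact key k 0

theorem tendsto_zero_of_orderContinuousPart_eq_univ [NormedSpace ℝ E] [IsOrderedModule ℝ E]
    (hE : orderContinuousPart E = Set.univ) {x : ℕ → E} (hx : IsDisjointSeq x) {w : E}
    (hw : ∀ n, |x n| ≤ w) : Tendsto x atTop (𝓝 0) := by
  set s : ℕ → E := fun n => ∑ i ∈ Finset.range n, |x i| with hs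
  have hmono : Monotone s := monotone_nat_of_le_succ fun n => by
    simp only [hs, Finset.sum_range_succ]
    exact le_add_of_nonneg_right (abs_nonneg _)
  have hsw : ∀ n, s n ≤ w := hx.sum_range_abs_le hw
  have hs0 : ∀ n, 0 ≤ s n := fun n => Finset.sum_nonneg fun i _ => abs_nonneg _
  have hmem : w ∈ orderContinuousPart E := hE ▸ Set.mem_univ w
  rw [Metric.tendsto_atTop]
  intro ε hε
  obtain ⟨_, ⟨u, n, hu, -, rfl⟩, hlt⟩ := hmem
    {d | ∃ u n, (∀ k, s k ≤ u) ∧ u ≤ w ∧ d = u - s n} ⟨w - s 0, w, 0, hsw, le_rfl, rfl⟩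
    (by
      rintro _ ⟨u, m, hu, huw, rfl⟩ _ ⟨u', n, hu', -, rfl⟩
      refine ⟨u ⊓ u' - s (max m n), ⟨_, _, fun k => le_inf (hu k) (hu' k),
        inf_le_left.trans huw, rfl⟩, ?_, ?_⟩
      · exact sub_le_sub inf_le_left (hmono (le_max_left _ _))
      · exact sub_le_sub inf_le_right (hmono (le_max_right _ _)))
    (isGLB_upperBound_sub hsw)
    (by
      rintro _ ⟨u, n, -, huw, rfl⟩
      exact (sub_le_self _ (hs0 n)).trans (huw.trans (le_abs_self w))) ε hε
  refine ⟨n, fun m hm => ?_⟩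
  rw [dist_zero_right, ← norm_abs_eq_norm]
  refine (norm_le_norm_of_nonneg_of_le (abs_nonneg _) ?_).trans_lt hlt
  -- The next partial sum is still below `u`, so `|x m| ≤ u - s m ≤ u - s n`.
  have h1 : s m + |x m| ≤ u := by simpa [hs, Finset.sum_range_succ] using hu (m + 1)
  exact le_sub_iff_add_le'.2 ((add_le_add_left (hmono hm) _).trans h1)

/-- If order bounded disjoint sequences are null, then so are the increments of order bounded
monotone sequences. -/
theorem tendsto_increments_of_disjoint [NormedSpace ℝ E] [IsOrderedModule ℝ E]
    {w : E} (hw : 0 ≤ w)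
    (H : ∀ x : ℕ → E, IsDisjointSeq x → (∀ n, |x n| ≤ w) → Tendsto x atTop (𝓝 0))
    {s : ℕ → E} (hs : Monotone s) (hs0 : ∀ n, 0 ≤ s n) (hsw : ∀ n, s n ≤ w) :
    Tendsto (fun n => s (n + 1) - s n) atTop (𝓝 0) := by
  -- At a fixed level the slices are disjoint: for `m < n` the first is below `(s (m + 1) - l)⁺`,
  -- the second below `(l - s (m + 1))⁺`.
  have hlevel : ∀ l : E, 0 ≤ l →
      Tendsto (fun n => (s (n + 1) - l)⁺ ⊓ (l - s n)⁺) atTop (𝓝 0) := by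
    intro l hl
    have hnn : ∀ n, 0 ≤ (s (n + 1) - l)⁺ ⊓ (l - s n)⁺ := fun n =>
      le_inf (posPart_nonneg _) (posPart_nonneg _)
    refine H _ (IsDisjointSeq.of_lt hnn fun m n hmn => ?_) fun n => ?_
    · refine inf_eq_zero_of_le (hnn m) (hnn n) inf_le_left (inf_le_right.trans ?_)
        (posPart_sub_inf_posPart_sub (s (m + 1)) l)
      exact posPart_mono (sub_le_sub_left (hs hmn) l)
    · rw [abs_of_nonneg (hnn n)]
      exact inf_le_left.trans (sup_le ((sub_le_self _ hl).trans (hsw _)) hw)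
  rw [tendsto_zero_iff_norm_tendsto_zero, Metric.tendsto_atTop]
  intro ε hε
  -- With `d = w / k`, the error term has norm below `ε / 2` and the levels reach `w`.
  obtain ⟨k, hk⟩ := exists_nat_gt (‖w‖ / (ε / 2))
  have hk0 : (0 : ℝ) < k := (by positivity : (0 : ℝ) ≤ ‖w‖ / (ε / 2)).trans_lt hk
  set d : E := (1 / (k : ℝ)) • w with hd
  have hd0 : 0 ≤ d := smul_nonneg (by positivity) hw
  have hkd : k • d = w := by
    rw [hd, ← Nat.cast_smul_eq_nsmul ℝ, smul_smul, mul_one_div_cancel hk0.ne', one_smul]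
  have hdn : ‖d‖ < ε / 2 := by
    rw [hd, norm_smul, Real.norm_of_nonneg (by positivity), one_div, inv_mul_lt_iff₀ hk0]
    rwa [div_lt_iff₀ (by positivity)] at hk
  have hsum : Tendsto (fun n => 2 • ∑ j ∈ Finset.range (k + 1),
      ((s (n + 1) - j • d)⁺ ⊓ (j • d - s n)⁺)) atTop (𝓝 0) := by
    have := (tendsto_finsetSum (Finset.range (k + 1))
      fun j _ => hlevel (j • d) (nsmul_nonneg hd0 j)).const_smul 2
    simpa using this
  obtain ⟨N, hN⟩ := Metric.tendsto_atTop.1 hsum (ε / 2) (by positivity)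
  refine ⟨N, fun n hn => ?_⟩
  have h1 := hN n hn
  rw [dist_zero_right] at h1
  rw [dist_zero_right, norm_norm]
  have h2 := sub_le_add_sum_levels (hs0 n) (hs0 (n + 1)) (hsw n) (hsw (n + 1)) hd0 k hkd.ge
  calc ‖s (n + 1) - s n‖ ≤ _ :=
        norm_le_norm_of_nonneg_of_le (sub_nonneg.2 (hs n.le_succ)) h2
    _ ≤ _ := norm_add_le _ _
    _ < ε := by linarith

theorem orderContinuousPart_eq_univ_of_disjoint [NormedSpace ℝ E] [IsOrderedModule ℝ E]
    [CompleteSpace E] (H : ∀ w : E, ∀ x : ℕ → E, IsDisjointSeq x → (∀ n, |x n| ≤ w) →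
      Tendsto x atTop (𝓝 0)) : orderContinuousPart E = Set.univ := by
  refine Set.eq_univ_of_forall fun x D hne hdir hglb hDx => ?_
  have hD0 : ∀ d ∈ D, 0 ≤ d := fun d hd => hglb.1 hd
  -- Otherwise iterating a choice of smaller elements gives a decreasing sequence in `D` whose steps
  -- stay larger than `η`.
  have hcauchy : ∀ η : ℝ, 0 < η → ∃ d ∈ D, ∀ d' ∈ D, d' ≤ d → ‖d - d'‖ ≤ η := by
    intro η hη
    by_contra! hcon
    choose! g hgD hgle hgη using hcon
    obtain ⟨d₀, hd₀⟩ := hne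
    have hmem : ∀ n, g^[n] d₀ ∈ D := fun n => by
      induction n with
      | zero => exact hd₀
      | succ n ih => rw [Function.iterate_succ_apply']; exact hgD _ ih
    have hanti : Antitone fun n => g^[n] d₀ := antitone_nat_of_succ_le fun n => by
      rw [Function.iterate_succ_apply']; exact hgle _ (hmem n)
    have hinc := tendsto_increments_of_disjoint (abs_nonneg x) (H |x|)
      (s := fun n => d₀ - g^[n] d₀) (fun m n hmn => sub_le_sub_left (hanti hmn) d₀)
      (fun n => sub_nonneg.2 (hanti n.zero_le))
      (fun n => (sub_le_self _ (hD0 _ (hmem n))).trans (hDx d₀ hd₀))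
    obtain ⟨n, hn⟩ := (Metric.tendsto_atTop.1 hinc η hη)
    have := hn n le_rfl
    rw [dist_zero_right, sub_sub_sub_cancel_left, Function.iterate_succ_apply'] at this
    exact lt_asymm this (hgη _ (hmem n))
  have hpow : Tendsto (fun k : ℕ => (1 / ((k : ℝ) + 1))) atTop (𝓝 0) :=
    tendsto_one_div_add_atTop_nhds_zero_nat
  choose e heD he using fun k : ℕ => hcauchy (1 / ((k : ℝ) + 1)) (by positivity)
  have hdist : ∀ j k, ‖e j - e k‖ ≤ 1 / ((j : ℝ) + 1) + 1 / ((k : ℝ) + 1) := by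
    intro j k
    obtain ⟨d, hd, hdj, hdk⟩ := hdir _ (heD j) _ (heD k)
    calc ‖e j - e k‖ = ‖(e j - d) - (e k - d)‖ := by rw [sub_sub_sub_cancel_right]
      _ ≤ ‖e j - d‖ + ‖e k - d‖ := norm_sub_le _ _
      _ ≤ _ := add_le_add (he j d hd hdj) (he k d hd hdk)
  have hcs : CauchySeq e := by
    refine Metric.cauchySeq_iff'.2 fun ε hε => ?_
    obtain ⟨N, hN⟩ := (hpow.eventually (gt_mem_nhds (half_pos hε))).exists_forall_of_atTop
    refine ⟨N, fun n hn => ?_⟩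
    rw [dist_eq_norm]
    linarith [hdist n N, hN n hn, hN N le_rfl]
  obtain ⟨l, hl⟩ := cauchySeq_tendsto_of_complete hcs
  have hl0 : 0 ≤ l := ge_of_tendsto' hl fun k => hD0 _ (heD k)
  -- Elements of `D` below both `d` and `e k` are within `1 / (k + 1)` of `e k`, so they also
  -- converge to `l`.
  have hlD : l ∈ lowerBounds D := by
    intro d hd
    choose d' hd'D hd'd hd'e using fun k => hdir _ hd _ (heD k)
    have hlim : Tendsto (fun k => e k - d' k) atTop (𝓝 0) :=
      squeeze_zero_norm (fun k => he k _ (hd'D k) (hd'e k)) hpow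
    have hlim' : Tendsto d' atTop (𝓝 l) := by simpa using hl.sub hlim
    exact le_of_tendsto' hlim' hd'd
  have hl_eq : l = 0 := le_antisymm (hglb.2 hlD) hl0
  intro ε hε
  rw [hl_eq] at hl
  obtain ⟨N, hN⟩ := Metric.tendsto_atTop.1 hl ε hε
  exact ⟨e N, heD N, by simpa using hN N le_rfl⟩

end NormedLattice

theorem tendsto_iSup_of_monotone_dual {E : Type*} [NormedAddCommGroup E]
    [NormedSpace ℝ E] [Lattice E] [IsOrderedAddMonoid E] {f : ℕ → StrongDual ℝ E} (hf : Monotone f)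
    (hb : Bornology.IsBounded (Set.range f)) {x : E} (hx : 0 ≤ x) :
    Tendsto (fun n => f n x) atTop (𝓝 (⨆ n, f n x)) := by
  obtain ⟨M, hM⟩ := isBounded_iff_forall_norm_le.1 hb
  refine tendsto_atTop_ciSup (fun m n hmn => hf hmn x hx) ⟨M * ‖x‖, ?_⟩
  rintro _ ⟨n, rfl⟩
  exact (le_abs_self _).trans ((f n).le_of_opNorm_le (hM _ ⟨n, rfl⟩) x)

theorem abs_apply_le_of_nonneg {E : Type*} [NormedAddCommGroup E] [NormedSpace ℝ E]
    [Lattice E] [IsOrderedAddMonoid E] {f : StrongDual ℝ E} (hf : ∀ x, 0 ≤ x → 0 ≤ f x) (x : E) :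
    |f x| ≤ f |x| := by
  rw [abs_le]
  constructor
  · have := hf (|x| + x) (neg_le_iff_add_nonneg.1 (neg_le_abs x))
    rw [map_add] at this
    linarith
  · have := hf (|x| - x) (sub_nonneg.2 (le_abs_self x))
    rw [map_sub] at this
    linarith

/-! ### Functionals built on the positive cone, and weak nullity from a KB dual -/

section Dual

variable {E : Type*} [NormedAddCommGroup E] [NormedSpace ℝ E] [Lattice E] [IsOrderedAddMonoid E]
  [HasSolidNorm E]

theorem norm_le_of_nonneg_of_le {f : StrongDual ℝ E} {C : ℝ} (hC : 0 ≤ C)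
    (hf : ∀ x, 0 ≤ x → 0 ≤ f x) (hfC : ∀ x, 0 ≤ x → f x ≤ C * ‖x‖) : ‖f‖ ≤ C := by
  refine f.opNorm_le_bound hC fun x => ?_
  rw [Real.norm_eq_abs, ← norm_abs_eq_norm x]
  exact (abs_apply_le_of_nonneg hf x).trans (hfC _ (abs_nonneg x))

/-- A bounded additive nonnegative function on the positive cone extends to a bounded
functional. -/
theorem exists_dual_of_additive (p : E → ℝ) {C : ℝ}
    (hadd : ∀ x y, 0 ≤ x → 0 ≤ y → p (x + y) = p x + p y) (h0 : ∀ x, 0 ≤ x → 0 ≤ p x)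
    (hC : ∀ x, 0 ≤ x → p x ≤ C * ‖x‖) : ∃ f : StrongDual ℝ E, ∀ x, 0 ≤ x → f x = p x := by
  have hp0 : p 0 = 0 := by simpa using hadd 0 0 le_rfl le_rfl
  let g : E →+ ℝ :=
    { toFun := fun x => p x⁺ - p x⁻
      map_zero' := by simp
      map_add' := fun x y => by
        have h1 : (x + y)⁺ + (x⁻ + y⁻) = (x + y)⁻ + (x⁺ + y⁺) := by
          have hx := posPart_sub_negPart x
          have hy := posPart_sub_negPart y
          have hxy := posPart_sub_negPart (x + y)
          rw [← sub_eq_zero]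
          calc _ = ((x + y)⁺ - (x + y)⁻) - (x⁺ - x⁻) - (y⁺ - y⁻) := by abel
            _ = 0 := by rw [hx, hy, hxy]; abel
        have h2 := congrArg p h1
        rw [hadd _ _ (posPart_nonneg _) (add_nonneg (negPart_nonneg _) (negPart_nonneg _)),
          hadd _ _ (negPart_nonneg _) (negPart_nonneg _),
          hadd _ _ (negPart_nonneg _) (add_nonneg (posPart_nonneg _) (posPart_nonneg _)),
          hadd _ _ (posPart_nonneg _) (posPart_nonneg _)] at h2
        linarith }
  have hC' : ∀ x, 0 ≤ x → p x ≤ |C| * ‖x‖ := fun x hx =>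
    (hC x hx).trans (mul_le_mul_of_nonneg_right (le_abs_self C) (norm_nonneg x))
  have hg : Continuous g := AddMonoidHomClass.continuous_of_bound g |C| fun x => by
    have h1 := (hC' x⁺ (posPart_nonneg x)).trans
      (mul_le_mul_of_nonneg_left (norm_posPart_le x) (abs_nonneg C))
    have h2 := (hC' x⁻ (negPart_nonneg x)).trans
      (mul_le_mul_of_nonneg_left (norm_negPart_le x) (abs_nonneg C))
    have h3 := h0 x⁺ (posPart_nonneg x)
    have h4 := h0 x⁻ (negPart_nonneg x)
    change |p x⁺ - p x⁻| ≤ _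
    rw [abs_le]
    constructor <;> linarith
  refine ⟨g.toRealLinearMap hg, fun x hx => ?_⟩
  change p x⁺ - p x⁻ = p x
  rw [posPart_of_nonneg hx, negPart_of_nonneg hx, hp0, sub_zero]

open Pointwise in
/-- The positive part of `φ`, restricted to the ideal generated by `u`. -/
theorem exists_dual_isLUB (φ : StrongDual ℝ E) (u : E) :
    ∃ ψ : StrongDual ℝ E, ∀ x, 0 ≤ x →
      IsLUB (φ '' {y | 0 ≤ y ∧ y ≤ x ∧ ∃ k : ℕ, y ≤ k • u}) (ψ x) := by
  set A : E → Set E := fun x => {y | 0 ≤ y ∧ y ≤ x ∧ ∃ k : ℕ, y ≤ k • u} with hA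
  have hzero : ∀ x, 0 ≤ x → (0 : ℝ) ∈ φ '' A x := fun x hx =>
    ⟨0, ⟨le_rfl, hx, 0, by simp⟩, map_zero φ⟩
  have hbd : ∀ x, ∀ r ∈ φ '' A x, r ≤ ‖φ‖ * ‖x‖ := by
    rintro x _ ⟨y, ⟨hy0, hyx, -⟩, rfl⟩
    exact (le_abs_self _).trans ((φ.le_opNorm y).trans
      (mul_le_mul_of_nonneg_left (norm_le_norm_of_nonneg_of_le hy0 hyx) (norm_nonneg _)))
  have hlub : ∀ x, 0 ≤ x → IsLUB (φ '' A x) (sSup (φ '' A x)) := fun x hx =>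
    isLUB_csSup ⟨0, hzero x hx⟩ ⟨_, hbd x⟩
  -- Riesz decomposition: `z ≤ x + y` splits as `z ⊓ x` plus `z - z ⊓ x ≤ y`.
  have hsplit : ∀ x y, 0 ≤ x → 0 ≤ y → φ '' A (x + y) = φ '' A x + φ '' A y := by
    intro x y hx hy
    refine Set.Subset.antisymm ?_ ?_
    · rintro _ ⟨z, ⟨hz0, hz, k, hk⟩, rfl⟩
      refine ⟨φ (z ⊓ x), ⟨_, ⟨le_inf hz0 hx, inf_le_right, k, inf_le_left.trans hk⟩, rfl⟩,
        φ (z - z ⊓ x), ⟨_, ⟨sub_nonneg.2 inf_le_left, ?_, k, ?_⟩, rfl⟩, ?_⟩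
      · rw [sub_inf, sub_self]
        exact sup_le hy (sub_le_iff_le_add'.2 hz)
      · exact (sub_le_self _ (le_inf hz0 hx)).trans hk
      · change φ (z ⊓ x) + φ (z - z ⊓ x) = φ z
        rw [← map_add, add_sub_cancel]
    · rintro _ ⟨_, ⟨z, ⟨hz0, hz, k, hk⟩, rfl⟩, _, ⟨z', ⟨hz0', hz', k', hk'⟩, rfl⟩, rfl⟩
      exact ⟨z + z', ⟨add_nonneg hz0 hz0', add_le_add hz hz', k + k',
        (add_le_add hk hk').trans (add_smul k k' u).ge⟩, map_add φ z z'⟩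
  obtain ⟨ψ, hψ⟩ := exists_dual_of_additive (fun x => sSup (φ '' A x)) (C := ‖φ‖)
    (fun x y hx hy => by
      refine (hlub (x + y) (add_nonneg hx hy)).unique ?_
      rw [hsplit x y hx hy]
      exact (hlub x hx).add (hlub y hy))
    (fun x hx => (hlub x hx).1 (hzero x hx))
    (fun x hx => (hlub x hx).2 (hbd x))
  exact ⟨ψ, fun x hx => hψ x hx ▸ hlub x hx⟩

/-- Let `ψ n` be the part of `φ⁺` carried by the ideal of `s n = ∑ i < n, |x i|`. It increases and
is norm bounded, so its increments tend to zero in norm. As `z n` lies in the ideal of `s (n + 1)`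
but is disjoint from `s n`, `φ (z n) ≤ (ψ (n + 1) - ψ n) (z n)`. -/
theorem eventually_apply_lt_of_isKBSpace_dual (hKB : IsKBSpace (StrongDual ℝ E))
    (φ : StrongDual ℝ E) {x z : ℕ → E} (hx : IsDisjointSeq x)
    (hb : Bornology.IsBounded (Set.range x)) (hz0 : ∀ n, 0 ≤ z n) (hzx : ∀ n, z n ≤ |x n|) {ε : ℝ}
    (hε : 0 < ε) : ∀ᶠ n in atTop, φ (z n) < ε := by
  set s : ℕ → E := fun n => ∑ i ∈ Finset.range n, |x i| with hs
  have hs0 : ∀ n, 0 ≤ s n := fun n => Finset.sum_nonneg fun i _ => abs_nonneg _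
  have hsmono : Monotone s := monotone_nat_of_le_succ fun n => by
    simp only [hs, Finset.sum_range_succ]
    exact le_add_of_nonneg_right (abs_nonneg _)
  choose ψ hψ using fun n => exists_dual_isLUB φ (s n)
  have hψ0 : ∀ n x, 0 ≤ x → 0 ≤ ψ n x := fun n x hx =>
    (hψ n x hx).1 ⟨0, ⟨le_rfl, hx, 0, by simp⟩, map_zero φ⟩
  have hψφ : ∀ n x, 0 ≤ x → ψ n x ≤ ‖φ‖ * ‖x‖ := by
    refine fun n x hx => (hψ n x hx).2 ?_
    rintro _ ⟨y, ⟨hy0, hyx, -⟩, rfl⟩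
    exact (le_abs_self _).trans ((φ.le_opNorm y).trans
      (mul_le_mul_of_nonneg_left (norm_le_norm_of_nonneg_of_le hy0 hyx) (norm_nonneg _)))
  have hmono : Monotone ψ := by
    refine fun m n hmn x hx => (hψ m x hx).2 ?_
    rintro _ ⟨y, ⟨hy0, hyx, k, hk⟩, rfl⟩
    exact (hψ n x hx).1 ⟨y, ⟨hy0, hyx, k, hk.trans (nsmul_le_nsmul_right (hsmono hmn) k)⟩, rfl⟩
  obtain ⟨l, hl⟩ := hKB ψ hmono (fun n x hx => by simpa using hψ0 n x hx)
    ((isBounded_iff_forall_norm_le).2 ⟨‖φ‖, by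
      rintro _ ⟨n, rfl⟩
      exact norm_le_of_nonneg_of_le (norm_nonneg _) (hψ0 n) (hψφ n)⟩)
  have hinc : Tendsto (fun n => ψ (n + 1) - ψ n) atTop (𝓝 0) := by
    simpa using ((tendsto_add_atTop_iff_nat 1).2 hl).sub hl
  obtain ⟨M, hM⟩ := isBounded_iff_forall_norm_le.1 hb
  have hlim : Tendsto (fun n => ‖ψ (n + 1) - ψ n‖ * |M|) atTop (𝓝 0) := by
    simpa using hinc.norm.mul_const |M|
  filter_upwards [hlim.eventually (gt_mem_nhds hε)] with n hn
  refine lt_of_le_of_lt ?_ hn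
  have h1 : φ (z n) ≤ ψ (n + 1) (z n) := (hψ _ _ (hz0 n)).1 ⟨z n, ⟨hz0 n, le_rfl, 1, by
    rw [one_smul]
    refine (hzx n).trans ?_
    simp only [hs, Finset.sum_range_succ]
    exact le_add_of_nonneg_left (hs0 n)⟩, rfl⟩
  have hdisj : s n ⊓ |x n| = 0 := sum_inf_eq_zero _ (fun i => abs_nonneg _) (abs_nonneg _)
    fun i hi => hx (Finset.mem_range.1 hi).ne
  have h2 : ψ n (z n) ≤ 0 := by
    refine (hψ _ _ (hz0 n)).2 ?_
    rintro _ ⟨y, ⟨hy0, hyz, k, hk⟩, rfl⟩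
    have : y ≤ 0 := by
      rw [← nsmul_inf_eq_zero (hs0 n) (abs_nonneg _) hdisj k]
      exact le_inf hk (hyz.trans (hzx n))
    rw [le_antisymm this hy0, map_zero]
  have hzM : ‖z n‖ ≤ |M| := by
    refine (norm_le_norm_of_nonneg_of_le (hz0 n) (hzx n)).trans ?_
    rw [norm_abs_eq_norm]
    exact (hM _ ⟨n, rfl⟩).trans (le_abs_self M)
  calc φ (z n) ≤ (ψ (n + 1) - ψ n) (z n) := by
        rw [sub_apply]; linarith
    _ ≤ ‖ψ (n + 1) - ψ n‖ * ‖z n‖ := (Real.le_norm_self _).trans (ContinuousLinearMap.le_opNorm _ _)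
    _ ≤ _ := mul_le_mul_of_nonneg_left hzM (norm_nonneg _)

theorem tendsto_apply_of_isKBSpace_dual (hKB : IsKBSpace (StrongDual ℝ E))
    (φ : StrongDual ℝ E) {x : ℕ → E} (hx : IsDisjointSeq x)
    (hb : Bornology.IsBounded (Set.range x)) : Tendsto (fun n => φ (x n)) atTop (𝓝 0) := by
  have hp : ∀ n, (x n)⁺ ≤ |x n| := fun n => sup_le (le_abs_self _) (abs_nonneg _)
  have hm : ∀ n, (x n)⁻ ≤ |x n| := fun n => sup_le (neg_le_abs _) (abs_nonneg _)
  have key : ∀ (z : ℕ → E), (∀ n, 0 ≤ z n) → (∀ n, z n ≤ |x n|) →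
      Tendsto (fun n => φ (z n)) atTop (𝓝 0) := by
    intro z hz0 hzx
    rw [Metric.tendsto_nhds]
    intro ε hε
    filter_upwards [eventually_apply_lt_of_isKBSpace_dual hKB φ hx hb hz0 hzx hε,
      eventually_apply_lt_of_isKBSpace_dual hKB (-φ) hx hb hz0 hzx hε] with n h1 h2
    rw [dist_zero_right, Real.norm_eq_abs, abs_lt]
    rw [neg_apply] at h2
    constructor <;> linarith
  have := (key _ (fun n => posPart_nonneg (x n)) hp).sub (key _ (fun n => negPart_nonneg (x n)) hm)
  simpa [← map_sub, posPart_sub_negPart] using this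

/-- A norm bounded increasing sequence of positive functionals has a pointwise limit. -/
theorem exists_dual_tendsto_of_monotone {f : ℕ → StrongDual ℝ E} (hf : Monotone f)
    (hf0 : ∀ n, 0 ≤ f n) (hb : Bornology.IsBounded (Set.range f)) :
    ∃ g : StrongDual ℝ E, ∀ x, Tendsto (fun n => f n x) atTop (𝓝 (g x)) := by
  obtain ⟨M, hM⟩ := isBounded_iff_forall_norm_le.1 hb
  have hlim := fun x hx => tendsto_iSup_of_monotone_dual (x := x) hf hb hx
  obtain ⟨g, hg⟩ := exists_dual_of_additive (fun x => ⨆ n, f n x) (C := M)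
    (fun x y hx hy => tendsto_nhds_unique (hlim _ (add_nonneg hx hy)) (by
      simpa using (hlim x hx).add (hlim y hy)))
    (fun x hx => ge_of_tendsto' (hlim x hx) fun n => by simpa using hf0 n x hx)
    (fun x hx => le_of_tendsto' (hlim x hx) fun n =>
      (le_abs_self _).trans ((f n).le_of_opNorm_le (hM _ ⟨n, rfl⟩) x))
  have hpos : ∀ x, 0 ≤ x → Tendsto (fun n => f n x) atTop (𝓝 (g x)) := fun x hx =>
    hg x hx ▸ hlim x hx
  refine ⟨g, fun x => ?_⟩
  have := (hpos _ (posPart_nonneg x)).sub (hpos _ (negPart_nonneg x))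
  simpa only [← map_sub, posPart_sub_negPart] using this

end Dual

/-! ### Disjointification, and the KB property from weak nullity -/

theorem posPart_smul_le {E : Type*} [AddCommGroup E] [Module ℝ E] [Lattice E]
    [IsOrderedModule ℝ E] {c : ℝ} (hc : 0 ≤ c) (a : E) : (c • a)⁺ ≤ c • a⁺ :=
  sup_le (smul_le_smul_of_nonneg_left (le_posPart a) hc) (smul_nonneg hc (posPart_nonneg a))

/-- The disjointification of a positive sequence. -/
theorem isDisjointSeq_posPart_sub {E : Type*} [AddCommGroup E] [Module ℝ E] [Lattice E]
    [IsOrderedAddMonoid E] [IsOrderedModule ℝ E] {z s : ℕ → E} {X : E} (hs : ∀ n, 0 ≤ s n) (hX : 0 ≤ X)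
    (hzs : ∀ m n, m < n → z m ≤ s n) (hzX : ∀ n, (1 / 2 : ℝ) ^ n • z n ≤ X) :
    IsDisjointSeq fun n => (z n - (4 : ℝ) ^ n • s n - (1 / 2 : ℝ) ^ n • X)⁺ := by
  refine IsDisjointSeq.of_lt (fun n => posPart_nonneg _) fun m n hmn => ?_
  -- Up to a positive factor, the two terms are dominated by the positive and negative parts of `z m
  -- - t`: `2⁻ᵐ X` absorbs `t`, and `4ⁿ s n` absorbs `4ⁿ z m`.
  set t : E := (1 / 4 : ℝ) ^ n • z n with ht
  have h1 : (z m - (4 : ℝ) ^ m • s m - (1 / 2 : ℝ) ^ m • X)⁺ ≤ (z m - t)⁺ := by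
    refine posPart_mono (sub_le_sub (sub_le_self _ (smul_nonneg (by positivity) (hs m))) ?_)
    calc t = (1 / 2 : ℝ) ^ n • ((1 / 2 : ℝ) ^ n • z n) := by
          rw [ht, smul_smul, ← mul_pow]; norm_num
      _ ≤ (1 / 2 : ℝ) ^ n • X := smul_le_smul_of_nonneg_left (hzX n) (by positivity)
      _ ≤ (1 / 2 : ℝ) ^ m • X := smul_le_smul_of_nonneg_right
          (pow_le_pow_of_le_one (by norm_num) (by norm_num) hmn.le) hX
  have h2 : (z n - (4 : ℝ) ^ n • s n - (1 / 2 : ℝ) ^ n • X)⁺ ≤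
      (4 ^ n : ℕ) • (t - z m)⁺ := by
    calc _ ≤ ((4 : ℝ) ^ n • (t - z m))⁺ := by
          refine posPart_mono ((sub_le_self _ (smul_nonneg (by positivity) hX)).trans ?_)
          rw [smul_sub, ht, smul_smul, ← mul_pow, mul_one_div_cancel four_ne_zero, one_pow,
            one_smul]
          exact sub_le_sub_left
            (smul_le_smul_of_nonneg_left (hzs m n hmn) (by positivity : (0 : ℝ) ≤ 4 ^ n)) _
      _ ≤ (4 : ℝ) ^ n • (t - z m)⁺ := posPart_smul_le (by positivity) _
      _ = _ := by rw [← Nat.cast_smul_eq_nsmul ℝ]; push_cast; rfl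
  refine inf_eq_zero_of_le (posPart_nonneg _) (posPart_nonneg _) h1 h2 ?_
  rw [inf_comm]
  exact nsmul_inf_eq_zero (posPart_nonneg _) (posPart_nonneg _) (posPart_sub_inf_posPart_sub _ _) _

section DualKB

variable {E : Type*} [NormedAddCommGroup E] [NormedSpace ℝ E] [Lattice E] [IsOrderedAddMonoid E]
  [IsOrderedModule ℝ E] [HasSolidNorm E]

theorem exists_nonneg_lt_apply {f : StrongDual ℝ E} (hf : ∀ x, 0 ≤ x → 0 ≤ f x) {ε : ℝ}
    (hε : 0 ≤ ε) (h : ε < ‖f‖) : ∃ x, 0 ≤ x ∧ ‖x‖ ≤ 1 ∧ ε < f x := by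
  by_contra! hcon
  refine h.not_ge (norm_le_of_nonneg_of_le hε hf fun x hx => ?_)
  rcases eq_or_ne x 0 with rfl | hx0
  · simp
  have hn : 0 < ‖x‖ := norm_pos_iff.2 hx0
  have := hcon (‖x‖⁻¹ • x) (smul_nonneg (by positivity) hx)
    (by rw [norm_smul, norm_inv, norm_norm, inv_mul_cancel₀ hn.ne'])
  rwa [map_smul, smul_eq_mul, inv_mul_le_iff₀ hn, mul_comm] at this

/-- If all norms exceed `ε`, choose positive `x n` in the unit ball with `G n (x n) > ε`. Pointwise
convergence allows a subsequence `z k` on which the sum `s k` of earlier terms is negligible for the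
current functional. Disjointifying costs at most `ε / 4` plus a vanishing term, so `G 0` stays near
or above `3ε / 4` on a bounded disjoint sequence. -/
theorem exists_norm_le_of_antitone_dual [CompleteSpace E]
    (H : ∀ (φ : StrongDual ℝ E) (x : ℕ → E), IsDisjointSeq x → Bornology.IsBounded (Set.range x) →
      Tendsto (fun n => φ (x n)) atTop (𝓝 0))
    {G : ℕ → StrongDual ℝ E} (hG : Antitone G) (hG0 : ∀ n x, 0 ≤ x → 0 ≤ G n x)
    (hlim : ∀ x, Tendsto (fun n => G n x) atTop (𝓝 0)) {ε : ℝ} (hε : 0 < ε) :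
    ∃ n, ‖G n‖ ≤ ε := by
  by_contra! hcon
  choose x hx0 hx1 hxε using fun n => exists_nonneg_lt_apply (hG0 n) hε.le (hcon n)
  have hN : ∀ (k : ℕ) (s : E), ∃ n, (4 : ℝ) ^ k * G n s < ε / 4 := by
    intro k s
    have h : Tendsto (fun n => (4 : ℝ) ^ k * G n s) atTop (𝓝 0) := by
      simpa using (hlim s).const_mul ((4 : ℝ) ^ k)
    exact (h.eventually (gt_mem_nhds (by positivity : (0 : ℝ) < ε / 4))).exists
  choose N hN using hN
  -- The next index depends only on `k` and the running sum, so recursion on the sum alone suffices.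
  let s : ℕ → E := fun n => Nat.rec 0 (fun k a => a + x (N k a)) n
  set z : ℕ → E := fun k => x (N k (s k)) with hz
  have hss : ∀ k, s (k + 1) = s k + z k := fun k => rfl
  have hz0 : ∀ k, 0 ≤ z k := fun k => hx0 _
  have hz1 : ∀ k, ‖z k‖ ≤ 1 := fun k => hx1 _
  have hsmono : Monotone s := monotone_nat_of_le_succ fun k => by
    rw [hss]; exact le_add_of_nonneg_right (hz0 k)
  have hs0 : ∀ k, 0 ≤ s k := fun k => hsmono k.zero_le
  have hzs : ∀ m n, m < n → z m ≤ s n := fun m n hmn =>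
    (hss m ▸ le_add_of_nonneg_left (hs0 m)).trans (hsmono (Nat.succ_le_of_lt hmn))
  have hterm : ∀ k, 0 ≤ (1 / 2 : ℝ) ^ k • z k := fun k => smul_nonneg (by positivity) (hz0 k)
  have hsum : Summable fun k => (1 / 2 : ℝ) ^ k • z k := by
    refine Summable.of_norm_bounded summable_geometric_two fun k => ?_
    rw [norm_smul, Real.norm_of_nonneg (by positivity)]
    exact mul_le_of_le_one_right (by positivity) (hz1 k)
  set X : E := ∑' k, (1 / 2 : ℝ) ^ k • z k with hX
  have hX0 : 0 ≤ X := tsum_nonneg hterm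
  have hzX : ∀ n, (1 / 2 : ℝ) ^ n • z n ≤ X := fun n => hsum.le_tsum n fun j _ => hterm j
  set y : ℕ → E := fun n => (z n - (4 : ℝ) ^ n • s n - (1 / 2 : ℝ) ^ n • X)⁺ with hy
  have hyz : ∀ n, y n ≤ z n := fun n => sup_le
    ((sub_le_self _ (smul_nonneg (by positivity) hX0)).trans
      (sub_le_self _ (smul_nonneg (by positivity) (hs0 n)))) (hz0 n)
  have hyb : Bornology.IsBounded (Set.range y) := isBounded_iff_forall_norm_le.2 ⟨1, by
    rintro _ ⟨n, rfl⟩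
    exact (norm_le_norm_of_nonneg_of_le (posPart_nonneg _) (hyz n)).trans (hz1 n)⟩
  have hy_lim := H (G 0) y (isDisjointSeq_posPart_sub hs0 hX0 hzs hzX) hyb
  have hlow : ∀ k, 3 * ε / 4 - (1 / 2 : ℝ) ^ k * G 0 X ≤ G 0 (y k) := by
    intro k
    have h1 : G (N k (s k)) (y k) ≤ G 0 (y k) := hG (Nat.zero_le _) _ (posPart_nonneg _)
    have h2 : G (N k (s k)) (z k - (4 : ℝ) ^ k • s k - (1 / 2 : ℝ) ^ k • X) ≤
        G (N k (s k)) (y k) := by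
      have := hG0 (N k (s k)) _ (sub_nonneg.2
        (le_posPart (z k - (4 : ℝ) ^ k • s k - (1 / 2 : ℝ) ^ k • X)))
      rw [map_sub] at this
      exact sub_nonneg.1 this
    rw [map_sub, map_sub, map_smul, map_smul, smul_eq_mul, smul_eq_mul] at h2
    have h3 : (1 / 2 : ℝ) ^ k * G (N k (s k)) X ≤ (1 / 2 : ℝ) ^ k * G 0 X :=
      mul_le_mul_of_nonneg_left (hG (Nat.zero_le _) _ hX0) (by positivity)
    have h4 := hN k (s k)
    have h5 : ε < G (N k (s k)) (z k) := hxε _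
    linarith
  have hlow_lim : Tendsto (fun k : ℕ => 3 * ε / 4 - (1 / 2 : ℝ) ^ k * G 0 X) atTop
      (𝓝 (3 * ε / 4)) := by
    have := (tendsto_pow_atTop_nhds_zero_of_lt_one (r := (1 / 2 : ℝ)) (by norm_num)
      (by norm_num)).mul_const (G 0 X)
    simpa using this.const_sub (3 * ε / 4)
  have := le_of_tendsto_of_tendsto' hlow_lim hy_lim hlow
  linarith

/-- The norm dual is a KB-space as soon as bounded disjoint sequences are weakly null. -/
theorem isKBSpace_dual_of_disjoint [CompleteSpace E]
    (H : ∀ (φ : StrongDual ℝ E) (x : ℕ → E), IsDisjointSeq x → Bornology.IsBounded (Set.range x) →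
      Tendsto (fun n => φ (x n)) atTop (𝓝 0)) : IsKBSpace (StrongDual ℝ E) := by
  intro f hf hf0 hb
  obtain ⟨g, hg⟩ := exists_dual_tendsto_of_monotone hf hf0 hb
  have hG : Antitone fun n => g - f n := fun m n hmn x hx => by
    simpa only [sub_apply] using sub_le_sub_left (hf hmn x hx) (g x)
  have hG0 : ∀ n x, 0 ≤ x → 0 ≤ (g - f n) x := fun n x hx => by
    simpa using Monotone.ge_of_tendsto (fun i j hij => hf hij x hx) (hg x) n
  have hlim : ∀ x, Tendsto (fun n => (g - f n) x) atTop (𝓝 0) := fun x => by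
    simpa using (hg x).const_sub (g x)
  refine ⟨g, Metric.tendsto_atTop.2 fun ε hε => ?_⟩
  obtain ⟨n, hn⟩ := exists_norm_le_of_antitone_dual H hG hG0 hlim (half_pos hε)
  refine ⟨n, fun m hm => ?_⟩
  rw [dist_comm, dist_eq_norm]
  refine lt_of_le_of_lt (norm_le_of_nonneg_of_le (norm_nonneg _) (hG0 m) fun x hx => ?_)
    (hn.trans_lt (half_lt_self hε))
  exact (hG hm x hx).trans ((Real.le_norm_self _).trans (ContinuousLinearMap.le_opNorm _ _))

end DualKB

/-! ### Rank one operators and the reduction of the theorem to disjoint sequences -/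

section RankOne

theorem ContinuousLinearMap.isRankOne_smulRight {E F : Type*} [NormedAddCommGroup E]
    [NormedSpace ℝ E] [NormedAddCommGroup F] [NormedSpace ℝ F]
    {φ : StrongDual ℝ E} {y : F} (hφ : φ ≠ 0) (hy : y ≠ 0) : IsRankOne (φ.smulRight y) := by
  have hrange : LinearMap.range ((φ.smulRight y : E →L[ℝ] F) : E →ₗ[ℝ] F) =
      Submodule.span ℝ {y} := by
    obtain ⟨x, hx⟩ := DFunLike.ne_iff.1 hφ
    refine le_antisymm ?_ ((Submodule.span_singleton_le_iff_mem _ _).2 ?_)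
    · rintro _ ⟨v, rfl⟩
      exact Submodule.smul_mem _ _ (Submodule.mem_span_singleton_self y)
    · refine ⟨(φ x)⁻¹ • x, ?_⟩
      change φ ((φ x)⁻¹ • x) • y = y
      rw [map_smul, smul_eq_mul, inv_mul_cancel₀ hx, one_smul]
  rw [IsRankOne, LinearMap.rank, hrange, Module.rank_eq_one_iff_finrank_eq_one]
  exact finrank_span_singleton hy

theorem IsRankOne.exists_eq_smul {E F : Type*} [NormedAddCommGroup E]
    [NormedSpace ℝ E] [NormedAddCommGroup F] [NormedSpace ℝ F] {T : E →L[ℝ] F}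
    (hT : IsRankOne T) : ∃ (φ : StrongDual ℝ E) (y : F), ∀ x, T x = φ x • y := by
  rw [IsRankOne, LinearMap.rank, Module.rank_eq_one_iff_finrank_eq_one, finrank_eq_one_iff'] at hT
  obtain ⟨⟨y, hyr⟩, hy0, hy⟩ := hT
  have hy0' : y ≠ 0 := fun h => hy0 (Subtype.ext h)
  obtain ⟨g, hg⟩ := SeparatingDual.exists_eq_one (R := ℝ) hy0'
  refine ⟨g.comp T, y, fun x => ?_⟩
  obtain ⟨c, hc⟩ := hy ⟨T x, x, rfl⟩
  have hc' : c • y = T x := congrArg Subtype.val hc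
  rw [ContinuousLinearMap.comp_apply, ← hc', map_smul, hg, smul_eq_mul, mul_one]

theorem exists_dual_abs_apply_le {F : Type*} [NormedAddCommGroup F] [NormedSpace ℝ F] [Lattice F]
    [IsOrderedAddMonoid F] {f : ℕ → StrongDual ℝ F} (hf : IsOrderBounded (Set.range f)) (y : F) :
    ∃ C, ∀ n, |f n y| ≤ C := by
  obtain ⟨a, b, hab⟩ := hf
  have key : ∀ z : F, 0 ≤ z → ∀ n, |f n z| ≤ |a z| + |b z| := by
    intro z hz n
    have h1 : a z ≤ f n z := (hab ⟨n, rfl⟩).1 z hz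
    have h2 : f n z ≤ b z := (hab ⟨n, rfl⟩).2 z hz
    rw [abs_le]
    constructor
    · linarith [neg_abs_le (a z), abs_nonneg (b z)]
    · linarith [le_abs_self (b z), abs_nonneg (a z)]
  refine ⟨(|a y⁺| + |b y⁺|) + (|a y⁻| + |b y⁻|), fun n => ?_⟩
  calc |f n y| = |f n y⁺ - f n y⁻| := by rw [← map_sub, posPart_sub_negPart]
    _ ≤ |f n y⁺| + |f n y⁻| := abs_sub _ _
    _ ≤ _ := add_le_add (key _ (posPart_nonneg y) n) (key _ (negPart_nonneg y) n)

end RankOne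

theorem mainTheorem9 {E F : Type*}
    [NormedAddCommGroup E] [NormedSpace ℝ E] [CompleteSpace E] [Lattice E]
    [IsOrderedAddMonoid E] [IsOrderedModule ℝ E] [HasSolidNorm E] [Nontrivial E]
    [NormedAddCommGroup F] [NormedSpace ℝ F] [CompleteSpace F] [Lattice F]
    [IsOrderedAddMonoid F] [IsOrderedModule ℝ F] [HasSolidNorm F] [Nontrivial F] :
    (IsKBSpace (StrongDual ℝ E) ↔ ∀ T : E →L[ℝ] F, IsRankOne T → IsOMwc T) ∧
    (orderContinuousPart F = Set.univ ↔ ∀ T : E →L[ℝ] F, IsRankOne T → IsOLwc T) := by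
  refine ⟨⟨fun hKB T hT f x hf hx hb => ?_, fun H => isKBSpace_dual_of_disjoint ?_⟩,
    ⟨fun hF T hT A hA => ?_, fun H => orderContinuousPart_eq_univ_of_disjoint ?_⟩⟩
  · obtain ⟨φ, y, hφ⟩ := hT.exists_eq_smul
    obtain ⟨C, hC⟩ := exists_dual_abs_apply_le hf y
    have h := tendsto_apply_of_isKBSpace_dual hKB φ hx hb
    simp only [hφ, map_smul, smul_eq_mul]
    refine squeeze_zero_norm (a := fun n => ‖φ (x n)‖ * C) (fun n => ?_) ?_
    · rw [norm_mul]
      exact mul_le_mul_of_nonneg_left (hC n) (norm_nonneg _)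
    · simpa using h.norm.mul_const C
  · intro φ x hx hb
    rcases eq_or_ne φ 0 with rfl | hφ
    · simp
    obtain ⟨y, hy⟩ := exists_ne (0 : F)
    obtain ⟨g, hg⟩ := SeparatingDual.exists_eq_one (R := ℝ) hy
    -- The constant sequence `g` is order bounded, and `g y = 1` turns `g (T (x n))` into `φ (x n)`.
    have := H _ (ContinuousLinearMap.isRankOne_smulRight hφ hy) (fun _ => g) x
      ⟨g, g, by rintro _ ⟨n, rfl⟩; exact ⟨le_rfl, le_rfl⟩⟩ hx hb
    simpa [hg] using this
  · obtain ⟨φ, y, hφ⟩ := hT.exists_eq_smul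
    obtain ⟨a, b, hab⟩ := hA
    have hb : ∀ x ∈ A, ‖x‖ ≤ ‖b - a‖ + ‖a‖ := fun x hx => by
      have := norm_le_norm_of_nonneg_of_le (sub_nonneg.2 (hab hx).1)
        (sub_le_sub_right (hab hx).2 a)
      calc ‖x‖ = ‖(x - a) + a‖ := by rw [sub_add_cancel]
        _ ≤ _ := (norm_add_le _ _).trans (by gcongr)
    -- `C` bounds `|φ|` on `A`, so the solid hull of `T '' A` lies in `[-C|y|, C|y|]`.
    set C : ℝ := ‖φ‖ * (‖b - a‖ + ‖a‖) with hC
    have hφC : ∀ x ∈ A, |φ x| ≤ C := fun x hx => (φ.le_opNorm x).trans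
      (mul_le_mul_of_nonneg_left (hb x hx) (norm_nonneg _))
    have hC0 : 0 ≤ C := by positivity
    constructor
    · refine isBounded_iff_forall_norm_le.2 ⟨C * ‖y‖, ?_⟩
      rintro _ ⟨x, hx, rfl⟩
      rw [hφ, norm_smul]
      exact mul_le_mul_of_nonneg_right (hφC x hx) (norm_nonneg _)
    · intro u hu huA
      refine tendsto_zero_of_orderContinuousPart_eq_univ hF hu (w := C • |y|) fun n => ?_
      have hmem := huA n
      simp only [solidHull, Set.mem_iUnion] at hmem
      obtain ⟨_, ⟨x, hx, rfl⟩, h1, h2⟩ := hmem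
      refine (abs_le'.2 ⟨h2, neg_le.1 h1⟩).trans ?_
      rw [hφ]
      have hle : ∀ c : ℝ, |c| ≤ C → c • y ≤ C • |y| := fun c hc => by
        have h3 : c • y ≤ |c| • |y| := by
          rcases le_total 0 c with h | h
          · rw [abs_of_nonneg h]
            exact smul_le_smul_of_nonneg_left (le_abs_self y) h
          · rw [abs_of_nonpos h, ← neg_smul_neg]
            exact smul_le_smul_of_nonneg_left (neg_le_abs y) (neg_nonneg.2 h)
        exact h3.trans (smul_le_smul_of_nonneg_right hc (abs_nonneg y))
      refine abs_le'.2 ⟨hle _ (hφC x hx), ?_⟩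
      rw [← neg_smul]
      exact hle _ (by rw [abs_neg]; exact hφC x hx)
  · intro w x hx hw
    rcases eq_or_ne w 0 with rfl | hw0
    · have : x = fun _ => 0 := funext fun n => by
        have h0 : |x n| = 0 := le_antisymm (hw n) (abs_nonneg _)
        rw [← norm_eq_zero, ← norm_abs_eq_norm, h0, norm_zero]
      rw [this]
      exact tendsto_const_nhds
    obtain ⟨e, he⟩ := exists_ne (0 : E)
    obtain ⟨φ, hφ⟩ := SeparatingDual.exists_eq_one (R := ℝ) he
    have hφ0 : φ ≠ 0 := fun h => by simp [h] at hφ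
    -- As `φ e = 1`, the singleton `{e}` is mapped onto `{w}`, whose solid hull is `[-|w|, |w|]`.
    refine (H _ (ContinuousLinearMap.isRankOne_smulRight hφ0 hw0) {e}
      ⟨e, e, by simp⟩).2 x hx fun n => ?_
    simp only [solidHull, Set.mem_iUnion]
    refine ⟨w, ⟨e, rfl, by simp [hφ]⟩, ?_, ?_⟩
    · exact neg_le.1 ((neg_le_abs (x n)).trans ((hw n).trans (le_abs_self w)))
    · exact (le_abs_self _).trans ((hw n).trans (le_abs_self w))
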